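/- Let $\mathbb{T}^2=\mathbb{R}^2/\mathbb{Z}^2$ be the flat torus with Lebesgue measure, and for $\epsilon>0$ let $\Omega_\epsilon=B(0,\epsilon)\subset\mathbb{T}^2$ be the open ball of radius $\epsilon$ about $0$ for the flat metric. For $\lambda\in\mathbb{R}$ and $u_0\in L^2(\mathbb{T}^2)$ (complex-valued) let $$\Pi_\lambda u_0=\sum_{(p,q)\in\mathbb{Z}^2,\ 2\pi\sqrt{p^2+q^2}=\lambda}\langle u_0,\varphi_{p,q}\rangle_{L^2(\mathbb{T}^2)}\,\varphi_{p,q},\qquad \varphi_{p,q}(x,y)=e^{2\pi i(px+qy)},$$ that is, $\Pi_\lambda$ is the orthogonal projection onto the eigenspace of $\sqrt{-\Delta}$ for the eigenvalue $\lambda$ (and $\Pi_\lambda=0$ if $\lambda$ is not an eigenvalue). Then there exists a constant $C>0$ such that for all $0<\epsilon<e^{-1}$, all $\lambda\le\epsilon^{-17}$ and all $u_0\in L^2(\mathbb{T}^2)$, $$\|\Pi_\lambda u_0\|_{L^2(\mathbb{T}^2)}^2\le \exp\exp\left(\frac{C\log\epsilon^{-1}}{\log\log\epsilon^{-1}}\right)\|\Pi_\lambda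 u_0\|_{L^2(\Omega_\epsilon)}^2 .$$ -/

import Mathlib

namespace TorusLowFreq

open MeasureTheory

noncomputable section

/-- The flat torus `𝕋² = ℝ² / ℤ²`, with its Lebesgue measure `volume` (of total mass `1`). -/
abbrev Torus : Type := UnitAddTorus (Fin 2)

/-- The complex Hilbert space `L²(𝕋²)`. -/
abbrev L2Torus : Type := Lp ℂ 2 (volume : Measure Torus)

/-- The exponential `(x, y) ↦ exp (2πi (p x + q y))`, `n = (p, q)`, as an element of `L²(𝕋²)`. -/
def expMode (n : Fin 2 → ℤ) : L2Torus :=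
  ContinuousMap.toLp (E := ℂ) 2 (volume : Measure Torus) ℂ (UnitAddTorus.mFourier n)

/-- The frequencies `(p, q) ∈ ℤ²` with `2π √(p² + q²) = l`, i.e. those whose exponential is an
eigenfunction of `√(-Δ)` with eigenvalue `l`. -/
def freqSet (l : ℝ) : Set (Fin 2 → ℤ) :=
  {n | 2 * Real.pi * Real.sqrt ((n 0 : ℝ) ^ 2 + (n 1 : ℝ) ^ 2) = l}

theorem freqSet_finite (l : ℝ) : (freqSet l).Finite := by
  refine (Set.finite_Icc (fun _ : Fin 2 => -⌈l⌉) (fun _ => ⌈l⌉)).subset ?_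
  intro n hn
  have hn' : 2 * Real.pi * Real.sqrt ((n 0 : ℝ) ^ 2 + (n 1 : ℝ) ^ 2) = l := hn
  have key : ∀ i, |n i| ≤ ⌈l⌉ := by
    intro i
    have h1 : |(n i : ℝ)| ≤ Real.sqrt ((n 0 : ℝ) ^ 2 + (n 1 : ℝ) ^ 2) := by
      apply Real.abs_le_sqrt
      fin_cases i
      · exact le_add_of_nonneg_right (sq_nonneg _)
      · exact le_add_of_nonneg_left (sq_nonneg _)
    have h2 : |(n i : ℝ)| ≤ l := by
      nlinarith [Real.pi_gt_three, Real.sqrt_nonneg ((n 0 : ℝ) ^ 2 + (n 1 : ℝ) ^ 2)]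
    have h3 : ((|n i| : ℤ) : ℝ) ≤ (⌈l⌉ : ℝ) := by
      push_cast
      exact h2.trans (Int.le_ceil l)
    exact_mod_cast h3
  exact ⟨fun i => (abs_le.mp (key i)).1, fun i => (abs_le.mp (key i)).2⟩

/-- The spectral projector `Π_l u = ∑ ⟨u, φ⟩ φ`, the sum over the exponentials `φ` that are
eigenfunctions of `√(-Δ)` with eigenvalue `l`. -/
def specProj (l : ℝ) (u : L2Torus) : L2Torus :=
  ∑ n ∈ (freqSet_finite l).toFinset, (inner ℂ (expMode n) u : ℂ) • expMode n

/-- The open ball `B(0, ε) ⊆ 𝕋²` of the flat metric. The norm on `ℝ / ℤ` is the distance to the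
nearest integer. -/
def smallBall (ε : ℝ) : Set Torus :=
  {x | Real.sqrt (‖x 0‖ ^ 2 + ‖x 1‖ ^ 2) < ε}

end

end TorusLowFreq

namespace TorusLowFreq

open MeasureTheory UniqueFactorizationMonoid UnitAddTorus

noncomputable section

/-! Put `L = log ε⁻¹`. The projection is a trigonometric polynomial whose `N` frequencies lie on one
circle, and two facts about it suffice. Arithmetic: those frequencies are Gaussian integers of a
fixed norm `m ≤ exp (34 L)`, so the divisor bound in `ℤ[i]` gives `N ≤ exp (O(L / log L))`
(`card_le_exp_of_norm_eq`). Analysis: the operator `f ↦ f(· + h) - e_n(h) f` kills frequency `n` and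
multiplies the coefficient at `n₀` by `e_{n₀}(h) - e_n(h)`, which has size at least `2δ` for some
`|h| ≤ δ`. Removing all frequencies but one leaves an exponential of constant modulus, so each
coefficient is controlled on a small ball (`norm_coeff_sq_mul_le`). With `δ = ε / (2N)` the total
loss is `(2N / ε) ^ (2N)`, a double exponential in `L / log L` (`pow_le_exp_exp`). -/

/-! ### Divisor bound in the Gaussian integers. -/

/-- The Gaussian integers with real and imaginary part in `[-k, k]`. -/
def gaussianBox (k : ℤ) : Finset GaussianInt :=
  (Finset.Icc (-k) k ×ˢ Finset.Icc (-k) k).image fun a => ⟨a.1, a.2⟩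

theorem card_gaussianBox_le (k : ℕ) : (gaussianBox k).card ≤ (2 * k + 1) ^ 2 := by
  refine Finset.card_image_le.trans (le_of_eq ?_)
  rw [Finset.card_product, Int.card_Icc, sq]
  congr <;> omega

theorem gaussian_norm_eq (z : GaussianInt) : z.norm = z.re ^ 2 + z.im ^ 2 := by
  rw [Zsqrtd.norm_def]; ring

theorem mem_gaussianBox_of_norm_le {z : GaussianInt} {k : ℤ} (h : z.norm ≤ k) :
    z ∈ gaussianBox k := by
  rw [gaussian_norm_eq] at h
  have key : ∀ a : ℤ, |a| ≤ a ^ 2 := fun a => by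
    rw [← sq_abs]
    rcases (abs_nonneg a).eq_or_lt with h0 | h0
    · rw [← h0]; norm_num
    · nlinarith
  have h1 := key z.re
  have h2 := key z.im
  have h3 := sq_nonneg z.re
  have h4 := sq_nonneg z.im
  refine Finset.mem_image.2 ⟨(z.re, z.im), ?_, rfl⟩
  rw [Finset.mem_product, Finset.mem_Icc, Finset.mem_Icc]
  exact ⟨abs_le.1 (by lia), abs_le.1 (by lia)⟩

theorem mem_gaussianBox_of_isUnit {z : GaussianInt} (h : IsUnit z) : z ∈ gaussianBox 1 := by
  refine mem_gaussianBox_of_norm_le ?_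
  rw [← GaussianInt.abs_natCast_norm, Zsqrtd.norm_eq_one_iff.2 h]
  rfl

/-- The number of Gaussian integers of norm `m` is at most a constant times the number of
divisors of `m`, up to units, in the Gaussian integers. -/
theorem card_le_of_norm_eq [NormalizationMonoid GaussianInt] {m : ℕ} (hm : m ≠ 0)
    (S : Finset GaussianInt) (hS : ∀ z ∈ S, z.norm = m) :
    S.card ≤ 9 * ∏ p ∈ (normalizedFactors (m : GaussianInt)).toFinset,
      ((normalizedFactors (m : GaussianInt)).count p + 1) := by
  have hm' : (m : GaussianInt) ≠ 0 := Nat.cast_ne_zero.2 hm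
  have hne : ∀ z ∈ S, z ≠ 0 := by
    rintro z hz rfl
    have := hS _ hz
    rw [Zsqrtd.norm_zero] at this
    exact hm (by exact_mod_cast this.symm)
  rw [← Multiset.card_Iic]
  -- Since `z * star z = m`, the factors of `z` form a sub-multiset of those of `m`. They determine
  -- `z` up to a unit, and the units lie in a box of 9 points.
  refine Finset.card_le_mul_card_image_of_maps_to (f := fun z => normalizedFactors z) ?_ 9 ?_
  · intro z hz
    rw [Finset.mem_Iic, ← dvd_iff_normalizedFactors_le_normalizedFactors (hne z hz) hm']
    refine ⟨star z, ?_⟩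
    rw [← Zsqrtd.norm_eq_mul_conj, hS z hz]
    simp
  · intro M _
    rcases Finset.eq_empty_or_nonempty {z ∈ S | normalizedFactors z = M} with h | ⟨w, hw⟩
    · rw [h]; simp
    · rw [Finset.mem_filter] at hw
      have hsub : {z ∈ S | normalizedFactors z = M} ⊆ (gaussianBox 1).image (w * ·) := by
        intro z hz
        rw [Finset.mem_filter] at hz
        obtain ⟨u, hu⟩ := (associated_iff_normalizedFactors_eq_normalizedFactors
          (hne w hw.1) (hne z hz.1)).2 (hw.2.trans hz.2.symm)
        exact Finset.mem_image.2 ⟨u, mem_gaussianBox_of_isUnit u.isUnit, hu⟩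
      exact (Finset.card_le_card hsub).trans
        (Finset.card_image_le.trans (card_gaussianBox_le 1))

theorem two_le_norm_of_prime {p : GaussianInt} (hp : Prime p) : 2 ≤ p.norm := by
  have h0 := GaussianInt.norm_pos.2 hp.ne_zero
  by_contra! h
  refine hp.not_isUnit (Zsqrtd.norm_eq_one_iff.1 ?_)
  lia

/-- Small primes: `x ^ (a η) ≥ 2 ^ (a η)` grows at least linearly in `a`, at the cost of a constant
per prime. -/
theorem add_one_le_mul_rpow {η x : ℝ} (hη : 0 < η) (hx : 2 ≤ x) (a : ℕ) :
    (a : ℝ) + 1 ≤ (1 + 1 / (η * Real.log 2)) * (x ^ a) ^ η := by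
  have hl : 0 < Real.log 2 := Real.log_pos one_lt_two
  have hb : 0 < η * Real.log 2 := by positivity
  have h1 : 1 + η * Real.log 2 * a ≤ (x ^ a) ^ η := by
    have h2 : ((2 : ℝ) ^ a) ^ η ≤ (x ^ a) ^ η := by gcongr
    refine le_trans ?_ h2
    rw [Real.rpow_def_of_pos (by positivity), Real.log_pow]
    have := Real.add_one_le_exp ((a : ℝ) * Real.log 2 * η)
    linarith
  calc (a : ℝ) + 1 ≤ (1 + 1 / (η * Real.log 2)) * (1 + η * Real.log 2 * a) := by
        have : 1 / (η * Real.log 2) * (η * Real.log 2) = 1 := by field_simp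
        have h3 : 0 ≤ 1 / (η * Real.log 2) := by positivity
        have h4 : 0 ≤ η * Real.log 2 * a := by positivity
        linear_combination h3 + h4 - (a : ℝ) * this
    _ ≤ _ := by gcongr

/-- Large primes: once `x ^ η ≥ 2`, the bound `a + 1 ≤ 2 ^ a` costs no constant. -/
theorem add_one_le_rpow {η T x : ℝ} (hη : 0 < η) (hT : 0 < T) (hTη : 2 ≤ T ^ η) (hx : T ≤ x)
    (a : ℕ) : (a : ℝ) + 1 ≤ (x ^ a) ^ η := by
  have h1 : (2 : ℝ) ≤ x ^ η := hTη.trans (by gcongr)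
  rw [← Real.rpow_natCast, ← Real.rpow_mul (hT.le.trans hx), mul_comm,
    Real.rpow_mul (hT.le.trans hx), Real.rpow_natCast]
  calc (a : ℝ) + 1 ≤ 2 ^ a := by exact_mod_cast Nat.lt_two_pow_self
    _ ≤ _ := by gcongr

/-- The number of divisors of a Gaussian integer, in terms of a threshold `T` between small and
large primes. -/
theorem prod_count_add_one_le [NormalizationMonoid GaussianInt] {w : GaussianInt} (hw : w ≠ 0)
    {η T : ℝ} (hη : 0 < η) (hT : 1 ≤ T) (hTη : 2 ≤ T ^ η) :
    ∏ p ∈ (normalizedFactors w).toFinset, (((normalizedFactors w).count p : ℝ) + 1) ≤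
      (1 + 1 / (η * Real.log 2)) ^ (9 * T ^ 2) * (w.norm : ℝ) ^ η := by
  set M := normalizedFactors w with hM
  set D := 1 + 1 / (η * Real.log 2) with hD
  have hl : 0 < Real.log 2 := Real.log_pos one_lt_two
  have hD1 : 1 ≤ D := by
    have : 0 ≤ 1 / (η * Real.log 2) := by positivity
    linarith
  have hprime : ∀ p ∈ M.toFinset, (2 : ℝ) ≤ (p.norm : ℝ) := fun p hp => by
    exact_mod_cast two_le_norm_of_prime (prime_of_normalized_factor p (Multiset.mem_toFinset.1 hp))
  have hnorm : ∏ p ∈ M.toFinset, (p.norm : ℝ) ^ M.count p = (w.norm : ℝ) := by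
    have h1 : M.prod.norm = w.norm := Zsqrtd.norm_eq_of_associated (by norm_num)
      (prod_normalizedFactors hw)
    rw [← h1, Finset.prod_multiset_count]
    have := map_prod (Zsqrtd.normMonoidHom (d := -1)) (fun p => p ^ M.count p) M.toFinset
    simp only [map_pow] at this
    change (∏ p ∈ M.toFinset, p ^ M.count p).norm = ∏ p ∈ M.toFinset, p.norm ^ M.count p at this
    rw [this]
    push_cast
    rfl
  have hstep : ∀ p ∈ M.toFinset, ((M.count p : ℝ) + 1) ≤
      (if (p.norm : ℝ) < T then D else 1) * ((p.norm : ℝ) ^ M.count p) ^ η := by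
    intro p hp
    split_ifs with h
    · exact add_one_le_mul_rpow hη (hprime p hp) _
    · rw [one_mul]
      exact add_one_le_rpow hη (by linarith) hTη (not_lt.1 h) _
  -- Small primes are counted crudely, by all lattice points in a box of half-side `⌊T⌋₊`.
  have hcard : ((({p ∈ M.toFinset | (p.norm : ℝ) < T} : Finset GaussianInt).card : ℕ) : ℝ) ≤
      9 * T ^ 2 := by
    have hsub : ({p ∈ M.toFinset | (p.norm : ℝ) < T} : Finset GaussianInt) ⊆
        gaussianBox (⌊T⌋₊ : ℕ) := by
      intro p hp
      rw [Finset.mem_filter] at hp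
      refine mem_gaussianBox_of_norm_le ?_
      rw [← GaussianInt.abs_natCast_norm]
      refine Int.ofNat_le.2 (Nat.le_floor ?_)
      rw [GaussianInt.natCast_natAbs_norm]
      exact hp.2.le
    have h1 : ((({p ∈ M.toFinset | (p.norm : ℝ) < T} : Finset GaussianInt).card : ℕ) : ℝ) ≤
        ((2 * ⌊T⌋₊ + 1) ^ 2 : ℕ) :=
      Nat.cast_le.2 ((Finset.card_le_card hsub).trans (card_gaussianBox_le _))
    refine h1.trans ?_
    push_cast
    have := Nat.floor_le (by linarith : 0 ≤ T)
    calc (2 * (⌊T⌋₊ : ℝ) + 1) ^ 2 ≤ (2 * T + T) ^ 2 := by gcongr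
      _ = _ := by ring
  calc ∏ p ∈ M.toFinset, ((M.count p : ℝ) + 1)
      ≤ ∏ p ∈ M.toFinset,
          (if (p.norm : ℝ) < T then D else 1) * ((p.norm : ℝ) ^ M.count p) ^ η :=
        Finset.prod_le_prod (fun p _ => by positivity) hstep
    _ = D ^ (({p ∈ M.toFinset | (p.norm : ℝ) < T} : Finset GaussianInt).card : ℝ) *
          (w.norm : ℝ) ^ η := by
        rw [Finset.prod_mul_distrib, Real.finsetProd_rpow, hnorm, Finset.prod_ite,
          Finset.prod_const, Finset.prod_const_one, mul_one, Real.rpow_natCast]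
        intro p hp
        have := hprime p hp
        positivity
    _ ≤ _ := by
        have : 0 ≤ (w.norm : ℝ) := by exact_mod_cast GaussianInt.norm_nonneg w
        gcongr

theorem one_le_div_log {L : ℝ} (hL : 1 < L) : 1 ≤ L / Real.log L := by
  rw [le_div_iff₀ (Real.log_pos hL), one_mul]
  linarith [Real.log_le_sub_one_of_pos (by linarith : 0 < L)]

/-- The number of Gaussian integers of norm `m` is `exp (O (log m / log log m))`. -/
theorem card_le_exp_of_norm_eq {m : ℕ} (S : Finset GaussianInt) (hS : ∀ z ∈ S, z.norm = m)
    {L : ℝ} (hL : 1 < L) (hm : Real.log m ≤ 34 * L) :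
    (S.card : ℝ) ≤ Real.exp (347 * (L / Real.log L)) := by
  have hQ := one_le_div_log hL
  rcases Nat.eq_zero_or_pos m with rfl | hm0
  · have hsub : S ⊆ {0} := fun z hz => by
      rw [Finset.mem_singleton, ← GaussianInt.norm_eq_zero, hS z hz]
      rfl
    have h1 : (S.card : ℝ) ≤ 1 := by exact_mod_cast Finset.card_le_card hsub
    exact h1.trans (Real.one_le_exp (by linarith))
  let _ : NormalizationMonoid GaussianInt :=
    (UniqueFactorizationMonoid.strongNormalizationMonoid (α := GaussianInt)).toNormalizationMonoid
  set s := Real.log L with hs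
  have hs0 : 0 < s := Real.log_pos hL
  have hLs : L = Real.exp s := (Real.exp_log (by linarith)).symm
  have hl0 : 0 < Real.log 2 := Real.log_pos one_lt_two
  have hl1 : 0.6931471803 < Real.log 2 := Real.log_two_gt_d9
  have hl2 : Real.log 2 < 0.6931471808 := Real.log_two_lt_d9
  have hT1 : 1 ≤ Real.exp (s / 4) := Real.one_le_exp (by positivity)
  -- The threshold is `T = L ^ (1/4)`, and `η` is chosen so that `T ^ η = 2`. Then the small primes
  -- cost `exp (9 √L log L)`, which is within the target, and `η` is of order `1 / log L`.
  have hTη : 2 ≤ Real.exp (s / 4) ^ (4 * Real.log 2 / s) := by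
    rw [← Real.exp_mul, show s / 4 * (4 * Real.log 2 / s) = Real.log 2 by field_simp,
      Real.exp_log two_pos]
  have hprod := prod_count_add_one_le (w := (m : GaussianInt)) (Nat.cast_ne_zero.2 hm0.ne')
    (by positivity : 0 < 4 * Real.log 2 / s) hT1 hTη
  have hD : (1 + 1 / (4 * Real.log 2 / s * Real.log 2)) ^ (9 * Real.exp (s / 4) ^ 2) ≤
      Real.exp (72 * (L / s)) := by
    have h1 : 1 + 1 / (4 * Real.log 2 / s * Real.log 2) ≤ Real.exp s := by
      have h2 : 1 / (4 * Real.log 2 / s * Real.log 2) ≤ s := by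
        rw [show 1 / (4 * Real.log 2 / s * Real.log 2) = s / (4 * Real.log 2 ^ 2) by field_simp]
        exact div_le_self hs0.le (by nlinarith)
      linarith [Real.add_one_le_exp s]
    have h3 : Real.exp (s / 4) ^ 2 = Real.exp (s / 2) := by
      rw [← Real.exp_nat_mul]; congr 1; push_cast; ring
    have h4 : L = Real.exp (s / 2) * Real.exp (s / 2) := by
      rw [← Real.exp_add, hLs]; congr 1; ring
    have h5 : s ^ 2 ≤ 8 * Real.exp (s / 2) := by
      nlinarith [Real.quadratic_le_exp_of_nonneg (by positivity : 0 ≤ s / 2)]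
    calc (1 + 1 / (4 * Real.log 2 / s * Real.log 2)) ^ (9 * Real.exp (s / 4) ^ 2)
        ≤ Real.exp s ^ (9 * Real.exp (s / 4) ^ 2) := by gcongr
      _ = Real.exp (s * (9 * Real.exp (s / 2))) := by rw [← Real.exp_mul, h3]
      _ ≤ _ := by
          rw [Real.exp_le_exp, mul_div_assoc', le_div_iff₀ hs0, h4]
          nlinarith [Real.exp_pos (s / 2)]
  have hN : (((m : GaussianInt).norm : ℤ) : ℝ) ^ (4 * Real.log 2 / s) ≤
      Real.exp (272 * (L / s)) := by
    have h1 : (((m : GaussianInt).norm : ℤ) : ℝ) = (m : ℝ) ^ 2 := by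
      rw [gaussian_norm_eq]; simp
    have h0 : (0 : ℝ) < m := by exact_mod_cast hm0
    rw [h1, Real.rpow_def_of_pos (by positivity), Real.exp_le_exp, Real.log_pow, mul_div_assoc',
      mul_div_assoc', div_le_div_iff_of_pos_right hs0]
    push_cast
    have h6 : 0 ≤ Real.log m := Real.log_nonneg (by exact_mod_cast hm0)
    nlinarith
  have h9 : (9 : ℝ) ≤ Real.exp (3 * (L / s)) := by
    have h1 : (9 : ℝ) ≤ Real.exp 3 := by
      have : Real.exp 3 = Real.exp 1 ^ 3 := by rw [← Real.exp_nat_mul]; norm_num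
      rw [this]
      calc (9 : ℝ) ≤ 2.7 ^ 3 := by norm_num
        _ ≤ _ := by gcongr; linarith [Real.exp_one_gt_d9]
    exact h1.trans (Real.exp_le_exp.2 (by linarith))
  have hcard : (S.card : ℝ) ≤ 9 * ∏ p ∈ (normalizedFactors (m : GaussianInt)).toFinset,
      (((normalizedFactors (m : GaussianInt)).count p : ℝ) + 1) := by
    exact_mod_cast card_le_of_norm_eq hm0.ne' S hS
  have hnn : (0 : ℝ) ≤ (((m : GaussianInt).norm : ℤ) : ℝ) := by
    exact_mod_cast GaussianInt.norm_nonneg _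
  calc (S.card : ℝ) ≤ 9 * _ := hcard
    -- `347 = 3 + 72 + 272`: units, small primes, and the norm `m ^ 2` raised to `η`.
    _ ≤ Real.exp (3 * (L / s)) * (Real.exp (72 * (L / s)) * Real.exp (272 * (L / s))) := by
        refine mul_le_mul h9 (hprod.trans ?_) (by positivity) (by positivity)
        exact mul_le_mul hD hN (by positivity) (by positivity)
    _ = _ := by
        rw [← Real.exp_add, ← Real.exp_add]; congr 1; ring

theorem card_freqSet_le {L l : ℝ} (hL : 1 < L) (hl : l ≤ Real.exp (17 * L)) :
    ((freqSet_finite l).toFinset.card : ℝ) ≤ Real.exp (347 * (L / Real.log L)) := by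
  rcases Finset.eq_empty_or_nonempty (freqSet_finite l).toFinset with h | ⟨n₀, hn₀⟩
  · rw [h, Finset.card_empty, Nat.cast_zero]; positivity
  have hpi := Real.pi_gt_three
  have hsq : ∀ n ∈ (freqSet_finite l).toFinset,
      (n 0 : ℝ) ^ 2 + (n 1 : ℝ) ^ 2 = (l / (2 * Real.pi)) ^ 2 := by
    intro n hn
    have hn' : 2 * Real.pi * Real.sqrt ((n 0 : ℝ) ^ 2 + (n 1 : ℝ) ^ 2) = l := by
      simpa [freqSet] using hn
    rw [← hn', mul_div_cancel_left₀ _ (by positivity), Real.sq_sqrt (by positivity)]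
  have hl0 : 0 ≤ l := by
    have hn' : 2 * Real.pi * Real.sqrt ((n₀ 0 : ℝ) ^ 2 + (n₀ 1 : ℝ) ^ 2) = l := by
      simpa [freqSet] using hn₀
    rw [← hn']; positivity
  set m := (n₀ 0 ^ 2 + n₀ 1 ^ 2).natAbs with hm
  have hm' : (m : ℤ) = n₀ 0 ^ 2 + n₀ 1 ^ 2 := by
    rw [hm, Int.natAbs_of_nonneg (by positivity)]
  have hinj : Function.Injective fun n : Fin 2 → ℤ => (⟨n 0, n 1⟩ : GaussianInt) := by
    intro a b hab
    rw [Zsqrtd.ext_iff] at hab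
    funext i
    fin_cases i
    exacts [hab.1, hab.2]
  rw [← Finset.card_image_of_injective _ hinj]
  refine card_le_exp_of_norm_eq (m := m) _ ?_ hL ?_
  · intro z hz
    obtain ⟨n, hn, rfl⟩ := Finset.mem_image.1 hz
    rw [gaussian_norm_eq, hm']
    exact_mod_cast (hsq n hn).trans (hsq n₀ hn₀).symm
  · have hmr : (m : ℝ) = (l / (2 * Real.pi)) ^ 2 := by
      rw [← hsq n₀ hn₀]; exact_mod_cast hm'
    rcases Nat.eq_zero_or_pos m with h0 | h0
    · rw [h0, Nat.cast_zero, Real.log_zero]; linarith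
    · rw [Real.log_le_iff_le_exp (by exact_mod_cast h0), hmr]
      calc (l / (2 * Real.pi)) ^ 2 ≤ l ^ 2 := by
            gcongr
            exact div_le_self hl0 (by linarith)
        _ ≤ Real.exp (17 * L) ^ 2 := by gcongr
        _ = _ := by rw [← Real.exp_nat_mul]; congr 1; push_cast; ring

/-! ### Exponentials and small balls on the torus. -/

theorem norm_mFourier_apply (n : Fin 2 → ℤ) (x : Torus) : ‖mFourier n x‖ = 1 := by
  simp only [mFourier, ContinuousMap.coe_mk, norm_prod, fourier_apply, Circle.norm_coe,
    Finset.prod_const_one]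

theorem mFourier_apply_add (n : Fin 2 → ℤ) (x h : Torus) :
    mFourier n (x + h) = mFourier n x * mFourier n h := by
  simp only [mFourier, ContinuousMap.coe_mk, ← Finset.prod_mul_distrib]
  refine Finset.prod_congr rfl fun i _ => ?_
  simp only [fourier_apply, Pi.add_apply, smul_add, AddCircle.toCircle_add, Circle.coe_mul]

theorem smallBall_subset {r r' : ℝ} (h : r ≤ r') : smallBall r ⊆ smallBall r' :=
  fun _ hx => lt_of_lt_of_le hx h

theorem measurableSet_smallBall (r : ℝ) : MeasurableSet (smallBall r) := by
  have : IsOpen (smallBall r) := by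
    refine isOpen_lt ?_ continuous_const
    fun_prop
  exact this.measurableSet

theorem sqrt_add_sq_le (a b c d : ℝ) :
    Real.sqrt ((a + c) ^ 2 + (b + d) ^ 2) ≤
      Real.sqrt (a ^ 2 + b ^ 2) + Real.sqrt (c ^ 2 + d ^ 2) := by
  have := norm_add_le (⟨a, b⟩ : ℂ) ⟨c, d⟩
  simpa [Complex.norm_eq_sqrt_sq_add_sq] using this

theorem add_mem_smallBall {r δ : ℝ} {x h : Torus} (hx : x ∈ smallBall r)
    (hh : Real.sqrt (‖h 0‖ ^ 2 + ‖h 1‖ ^ 2) ≤ δ) : x + h ∈ smallBall (r + δ) := by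
  have hx' : Real.sqrt (‖x 0‖ ^ 2 + ‖x 1‖ ^ 2) < r := hx
  change Real.sqrt (‖x 0 + h 0‖ ^ 2 + ‖x 1 + h 1‖ ^ 2) < r + δ
  calc Real.sqrt (‖x 0 + h 0‖ ^ 2 + ‖x 1 + h 1‖ ^ 2)
      ≤ Real.sqrt ((‖x 0‖ + ‖h 0‖) ^ 2 + (‖x 1‖ + ‖h 1‖) ^ 2) := by
        gcongr <;> exact norm_add_le _ _
    _ ≤ _ := sqrt_add_sq_le _ _ _ _
    _ < r + δ := by linarith

/-- The ball contains a square of side `r`. -/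
theorem sq_le_volume_smallBall {r : ℝ} (hr : 0 < r) (hr1 : r ≤ 1) :
    r ^ 2 ≤ (volume : Measure Torus).real (smallBall r) := by
  have hsub : Set.univ.pi (fun _ : Fin 2 => Metric.closedBall (0 : UnitAddCircle) (r / 2)) ⊆
      smallBall r := by
    intro x hx
    have h0 : ‖x 0‖ ≤ r / 2 := by simpa using hx 0 (Set.mem_univ _)
    have h1 : ‖x 1‖ ≤ r / 2 := by simpa using hx 1 (Set.mem_univ _)
    change Real.sqrt (‖x 0‖ ^ 2 + ‖x 1‖ ^ 2) < r
    rw [Real.sqrt_lt' hr]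
    nlinarith [norm_nonneg (x 0), norm_nonneg (x 1)]
  refine le_trans (le_of_eq ?_) (measureReal_mono hsub)
  rw [measureReal_def, volume_pi_pi]
  simp only [AddCircle.volume_closedBall, Finset.prod_const, Finset.card_univ, Fintype.card_fin]
  rw [show min 1 (2 * (r / 2)) = r by rw [min_eq_right] <;> linarith, ENNReal.toReal_pow,
    ENNReal.toReal_ofReal hr.le]

theorem norm_fourier_sub_one (k : ℤ) (t : ℝ) :
    ‖fourier k (t : UnitAddCircle) - 1‖ = 2 * |Real.sin (Real.pi * (k * t))| := by
  rw [fourier_coe_apply]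
  have : (2 * (Real.pi : ℂ) * Complex.I * k * t / (1 : ℝ)) =
      Complex.I * ((2 * (Real.pi * (k * t)) : ℝ) : ℂ) := by
    push_cast; ring
  rw [this, Complex.norm_exp_I_mul_ofReal_sub_one, mul_div_cancel_left₀ _ two_ne_zero, norm_mul,
    Real.norm_eq_abs, Real.norm_eq_abs, abs_two]

theorem exists_small_two_mul_le_norm_fourier_sub_one {k : ℤ} (hk : k ≠ 0) {δ : ℝ} (hδ : 0 < δ)
    (hδ1 : δ ≤ 1 / 2) :
    ∃ t : ℝ, |t| ≤ δ ∧ 2 * δ ≤ ‖fourier k (t : UnitAddCircle) - 1‖ := by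
  have hk1 : (1 : ℝ) ≤ |(k : ℝ)| := by exact_mod_cast Int.one_le_abs hk
  have hk0 : (0 : ℝ) < |(k : ℝ)| := by linarith
  -- The cap `1 / (2|k|)` keeps `π|k|t` in `[0, π/2]`, where `sin` lies above its chord.
  set t := min δ (1 / (2 * |(k : ℝ)|)) with ht
  have ht0 : 0 < t := lt_min hδ (by positivity)
  refine ⟨t, (abs_of_pos ht0).trans_le (min_le_left _ _), ?_⟩
  have hlow : δ ≤ |(k : ℝ)| * t := by
    rw [ht, mul_min_of_nonneg _ _ hk0.le]
    refine le_min (by nlinarith) ?_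
    rwa [show |(k : ℝ)| * (1 / (2 * |(k : ℝ)|)) = 1 / 2 by field_simp]
  have hup : |(k : ℝ)| * t ≤ 1 / 2 := by
    calc |(k : ℝ)| * t ≤ |(k : ℝ)| * (1 / (2 * |(k : ℝ)|)) := by
          gcongr; exact min_le_right _ _
      _ = 1 / 2 := by field_simp
  have hpi := Real.pi_pos
  have hsin : 2 * (|(k : ℝ)| * t) ≤ |Real.sin (Real.pi * (k * t))| := by
    have h1 : |Real.sin (Real.pi * (k * t))| = |Real.sin (Real.pi * (|(k : ℝ)| * t))| := by
      rcases abs_choice (k : ℝ) with h | h <;> rw [h]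
      rw [neg_mul, mul_neg, Real.sin_neg, abs_neg]
    rw [h1]
    refine le_trans ?_ (le_abs_self _)
    have := Real.mul_le_sin (x := Real.pi * (|(k : ℝ)| * t)) (by positivity) (by nlinarith)
    rwa [show 2 / Real.pi * (Real.pi * (|(k : ℝ)| * t)) = 2 * (|(k : ℝ)| * t) by
      field_simp] at this
  rw [norm_fourier_sub_one]
  linarith

/-- Two distinct frequencies are told apart by a small translation. -/
theorem exists_small_two_mul_le_norm_mFourier_sub {n m : Fin 2 → ℤ} (hnm : n ≠ m) {δ : ℝ}
    (hδ : 0 < δ) (hδ1 : δ ≤ 1 / 2) :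
    ∃ h : Torus, Real.sqrt (‖h 0‖ ^ 2 + ‖h 1‖ ^ 2) ≤ δ ∧
      2 * δ ≤ ‖mFourier n h - mFourier m h‖ := by
  obtain ⟨i, hi⟩ := Function.ne_iff.1 hnm
  obtain ⟨t, ht, hk⟩ := exists_small_two_mul_le_norm_fourier_sub_one (sub_ne_zero.2 hi) hδ hδ1
  refine ⟨Pi.single i (t : UnitAddCircle), ?_, ?_⟩
  · have h1 : ‖(t : UnitAddCircle)‖ ≤ δ := (QuotientAddGroup.norm_mk_le_norm).trans ht
    fin_cases i <;> simpa [Pi.single_apply] using h1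
  · have h1 : mFourier (n - m) (Pi.single i (t : UnitAddCircle) : Torus) =
        fourier (n i - m i) (t : UnitAddCircle) := by
      rw [mFourier, ContinuousMap.coe_mk, Finset.prod_eq_single i]
      · simp
      · intro j _ hj
        rw [Pi.single_eq_of_ne hj, fourier_eval_zero]
      · simp
    have h2 : mFourier n (Pi.single i (t : UnitAddCircle) : Torus) =
        mFourier (n - m) (Pi.single i (t : UnitAddCircle) : Torus) *
          mFourier m (Pi.single i (t : UnitAddCircle) : Torus) := by
      rw [← mFourier_add, sub_add_cancel]
    rw [h2, ← sub_one_mul, norm_mul, norm_mFourier_apply, mul_one, h1]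
    exact hk

/-! ### Removing frequencies by differences of translates. -/

theorem integrable_norm_sq {f : Torus → ℂ} (hf : Continuous f) :
    Integrable (fun x => ‖f x‖ ^ 2) (volume : Measure Torus) :=
  (by fun_prop : Continuous fun x => ‖f x‖ ^ 2).integrable_of_hasCompactSupport
    (HasCompactSupport.of_compactSpace _)

theorem setIntegral_norm_sq_mono {f : Torus → ℂ} (hf : Continuous f) {s t : Set Torus}
    (h : s ⊆ t) : ∫ x in s, ‖f x‖ ^ 2 ≤ ∫ x in t, ‖f x‖ ^ 2 :=
  setIntegral_mono_set (integrable_norm_sq hf).integrableOn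
    (Filter.Eventually.of_forall fun _ => by positivity) h.eventuallyLE

/-- Translation by `h` moves the ball into one of radius `r + δ`. The factor 4 is later cancelled by
the `(2δ) ^ 2` gained on the coefficient. -/
theorem setIntegral_norm_translate_sub_sq_le {f : Torus → ℂ} (hf : Continuous f) {w : ℂ}
    (hw : ‖w‖ = 1) {h : Torus} {r δ : ℝ} (hh : Real.sqrt (‖h 0‖ ^ 2 + ‖h 1‖ ^ 2) ≤ δ) :
    ∫ x in smallBall r, ‖f (x + h) - w * f x‖ ^ 2 ≤
      4 * ∫ x in smallBall (r + δ), ‖f x‖ ^ 2 := by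
  have hδ : 0 ≤ δ := (Real.sqrt_nonneg _).trans hh
  have hfh : Continuous fun x => f (x + h) := by fun_prop
  have hfd : Continuous fun x => f (x + h) - w * f x := by fun_prop
  have h1 : ∫ x in smallBall r, ‖f (x + h)‖ ^ 2 ≤ ∫ x in smallBall (r + δ), ‖f x‖ ^ 2 := by
    rw [← (measurePreserving_add_right (volume : Measure Torus) h).setIntegral_preimage_emb
      (MeasurableEquiv.addRight h).measurableEmbedding (fun x => ‖f x‖ ^ 2)]
    exact setIntegral_norm_sq_mono hfh fun x hx => add_mem_smallBall hx hh
  have h2 : ∫ x in smallBall r, ‖f x‖ ^ 2 ≤ ∫ x in smallBall (r + δ), ‖f x‖ ^ 2 :=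
    setIntegral_norm_sq_mono hf (smallBall_subset (by linarith))
  calc ∫ x in smallBall r, ‖f (x + h) - w * f x‖ ^ 2
      ≤ ∫ x in smallBall r, (2 * ‖f (x + h)‖ ^ 2 + 2 * ‖f x‖ ^ 2) := by
        refine setIntegral_mono_on (integrable_norm_sq hfd).integrableOn
          (((integrable_norm_sq hfh).const_mul 2).add
            ((integrable_norm_sq hf).const_mul 2)).integrableOn (measurableSet_smallBall r) ?_
        intro x _
        have h3 : ‖f (x + h) - w * f x‖ ≤ ‖f (x + h)‖ + ‖f x‖ := by
          refine (norm_sub_le _ _).trans_eq ?_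
          rw [norm_mul, hw, one_mul]
        calc ‖f (x + h) - w * f x‖ ^ 2 ≤ (‖f (x + h)‖ + ‖f x‖) ^ 2 := by gcongr
          _ ≤ _ := by nlinarith [sq_nonneg (‖f (x + h)‖ - ‖f x‖)]
    _ = 2 * (∫ x in smallBall r, ‖f (x + h)‖ ^ 2) + 2 * ∫ x in smallBall r, ‖f x‖ ^ 2 := by
        rw [integral_add ((integrable_norm_sq hfh).const_mul 2).integrableOn
          ((integrable_norm_sq hf).const_mul 2).integrableOn, integral_const_mul,
          integral_const_mul]
    _ ≤ _ := by linarith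

/-- The trigonometric polynomial with frequencies in `S` and coefficients `c`. -/
def trigPoly (S : Finset (Fin 2 → ℤ)) (c : (Fin 2 → ℤ) → ℂ) (x : Torus) : ℂ :=
  ∑ n ∈ S, c n * mFourier n x

theorem continuous_trigPoly (S : Finset (Fin 2 → ℤ)) (c : (Fin 2 → ℤ) → ℂ) :
    Continuous (trigPoly S c) := by
  unfold trigPoly
  fun_prop

/-- A coefficient of a trigonometric polynomial is controlled by the polynomial on a small ball:
the other frequencies are removed one at a time by differences of small translates. -/
theorem norm_coeff_sq_mul_le {δ : ℝ} (hδ : 0 < δ) (hδ1 : δ ≤ 1 / 2) (n₀ : Fin 2 → ℤ)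
    (S : Finset (Fin 2 → ℤ)) (hn₀ : n₀ ∉ S) (c : (Fin 2 → ℤ) → ℂ) (r : ℝ) :
    ‖c n₀‖ ^ 2 * δ ^ (2 * S.card) * (volume : Measure Torus).real (smallBall r) ≤
      ∫ x in smallBall (r + S.card * δ), ‖trigPoly (insert n₀ S) c x‖ ^ 2 := by
  induction S using Finset.induction_on generalizing c r with
  | empty =>
    simp [trigPoly, norm_mFourier_apply, mul_comm]
  | insert n S hn ih =>
    rw [Finset.mem_insert, not_or] at hn₀
    obtain ⟨h, hh, hd⟩ := exists_small_two_mul_le_norm_mFourier_sub hn₀.1 hδ hδ1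
    -- Coefficients of the difference; `c' n = 0`, so the induction hypothesis applies with one
    -- frequency fewer.
    set c' : (Fin 2 → ℤ) → ℂ := fun k => c k * (mFourier k h - mFourier n h) with hc'
    set f := trigPoly (insert n₀ (insert n S)) c with hf
    have hdiff : ∀ x, trigPoly (insert n₀ S) c' x = f (x + h) - mFourier n h * f x := by
      intro x
      have h1 : trigPoly (insert n₀ S) c' x = trigPoly (insert n₀ (insert n S)) c' x := by
        refine Finset.sum_subset
          (Finset.insert_subset_insert _ (Finset.subset_insert _ _)) fun k hk hk' => ?_
        have : k = n := by
          simp only [Finset.mem_insert, not_or] at hk hk'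
          tauto
        simp [hc', this]
      rw [h1, hf]
      simp only [trigPoly, Finset.mul_sum, ← Finset.sum_sub_distrib, hc', mFourier_apply_add]
      refine Finset.sum_congr rfl fun k _ => by ring
    have hih := ih hn₀.2 c' r
    have hshift := setIntegral_norm_translate_sub_sq_le (continuous_trigPoly _ c)
      (norm_mFourier_apply n h) hh (r := r + S.card * δ) (f := f)
    simp only [hdiff] at hih
    have hc : ‖c n₀‖ ^ 2 * (4 * δ ^ 2) ≤ ‖c' n₀‖ ^ 2 := by
      rw [hc', norm_mul, mul_pow]
      gcongr
      calc 4 * δ ^ 2 = (2 * δ) ^ 2 := by ring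
        _ ≤ _ := by gcongr
    rw [Finset.card_insert_of_notMem hn]
    have hrad : r + ((S.card + 1 : ℕ) : ℝ) * δ = r + S.card * δ + δ := by push_cast; ring
    rw [hrad]
    have hmul := mul_le_mul_of_nonneg_right hc
      (by positivity : 0 ≤ δ ^ (2 * S.card) * (volume : Measure Torus).real (smallBall r))
    rw [show 2 * (S.card + 1) = 2 * S.card + 2 by ring, pow_add]
    linarith

/-! ### Observability of the projection from the ball. -/

theorem norm_expMode_le (n : Fin 2 → ℤ) : ‖expMode n‖ ≤ 1 := by
  have hvol : (volume : Measure Torus) Set.univ = 1 := by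
    rw [← Set.pi_univ Set.univ, volume_pi_pi]
    simp [AddCircle.measure_univ]
  have h1 := Lp.norm_le_of_ae_bound (f := expMode n) zero_le_one (by
    filter_upwards [ContinuousMap.coeFn_toLp (p := 2) (𝕜 := ℂ) (volume : Measure Torus)
      (mFourier n)] with x hx
    rw [expMode, hx, norm_mFourier_apply])
  simpa [measureUnivNNReal, hvol] using h1

theorem specProj_ae_eq (l : ℝ) (u : L2Torus) :
    (specProj l u : Torus → ℂ) =ᵐ[volume]
      trigPoly (freqSet_finite l).toFinset fun n => inner ℂ (expMode n) u := by
  have hall : ∀ᵐ x ∂(volume : Measure Torus), ∀ n ∈ (freqSet_finite l).toFinset,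
      ((inner ℂ (expMode n) u • expMode n : L2Torus) : Torus → ℂ) x =
        inner ℂ (expMode n) u * mFourier n x := by
    rw [Finset.eventually_all]
    intro n _
    filter_upwards [Lp.coeFn_smul (inner ℂ (expMode n) u) (expMode n),
      ContinuousMap.coeFn_toLp (p := 2) (𝕜 := ℂ) (volume : Measure Torus) (mFourier n)]
      with x hx hx'
    rw [hx, Pi.smul_apply, smul_eq_mul]
    congr 1
  filter_upwards [Lp.coeFn_finsetSum (freqSet_finite l).toFinset
    (fun n => (inner ℂ (expMode n) u • expMode n : L2Torus)), hall] with x hx hx'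
  rw [specProj, hx, Finset.sum_apply]
  exact Finset.sum_congr rfl hx'

theorem norm_specProj_sq_mul_le (l : ℝ) (u : L2Torus) {ε : ℝ} (hε : 0 < ε) (hε1 : ε ≤ 1) {N : ℕ}
    (hN : (freqSet_finite l).toFinset.card = N) (hN0 : N ≠ 0) :
    ‖specProj l u‖ ^ 2 * (ε / (2 * N)) ^ (2 * N) ≤
      ∫ x in smallBall ε, ‖specProj l u x‖ ^ 2 := by
  set S := (freqSet_finite l).toFinset with hS
  set c : (Fin 2 → ℤ) → ℂ := fun n => inner ℂ (expMode n) u with hc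
  -- Starting from radius `ε / 2`, the `N - 1` enlargements by `δ` stay within `ε`. The volume
  -- factor `(ε / 2) ^ 2 = N ^ 2 * δ ^ 2` supplies the missing `δ ^ 2`, and its `N ^ 2` pays for
  -- Cauchy–Schwarz and for summing `N` coefficients.
  set δ := ε / (2 * N) with hδ
  set I := ∫ x in smallBall ε, ‖trigPoly S c x‖ ^ 2 with hI
  have hN1 : (1 : ℝ) ≤ N := by exact_mod_cast Nat.one_le_iff_ne_zero.2 hN0
  have hNpos : (0 : ℝ) < N := by linarith
  have hδ0 : 0 < δ := by positivity
  have hNδ : N * δ = ε / 2 := by rw [hδ]; field_simp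
  have hint : ∫ x in smallBall ε, ‖specProj l u x‖ ^ 2 = I := by
    refine integral_congr_ae ?_
    filter_upwards [ae_restrict_of_ae (specProj_ae_eq l u)] with x hx
    rw [hx]
  have hcoeff : ∀ n ∈ S, ‖c n‖ ^ 2 * (N ^ 2 * δ ^ (2 * N)) ≤ I := by
    intro n hn
    have hcard : (S.erase n).card = N - 1 := by rw [Finset.card_erase_of_mem hn, hN]
    have h1 := norm_coeff_sq_mul_le hδ0 (by nlinarith) n (S.erase n) (Finset.notMem_erase n S) c
      (ε / 2)
    rw [Finset.insert_erase hn, hcard] at h1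
    have h2 : ∫ x in smallBall (ε / 2 + ((N - 1 : ℕ) : ℝ) * δ), ‖trigPoly S c x‖ ^ 2 ≤ I := by
      refine setIntegral_norm_sq_mono (continuous_trigPoly S c) (smallBall_subset ?_)
      have : ((N - 1 : ℕ) : ℝ) * δ ≤ N * δ := by
        gcongr
        exact Nat.sub_le N 1
      linarith
    have h3 := sq_le_volume_smallBall (half_pos hε) (by linarith)
    refine le_trans (le_of_eq ?_) ((mul_le_mul_of_nonneg_left h3
      (by positivity : 0 ≤ ‖c n‖ ^ 2 * δ ^ (2 * (N - 1)))).trans (h1.trans h2))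
    rw [← hNδ, show 2 * N = 2 * (N - 1) + 2 by omega, pow_add]
    ring
  have hnorm : ‖specProj l u‖ ^ 2 ≤ N * ∑ n ∈ S, ‖c n‖ ^ 2 := by
    have h1 : ‖specProj l u‖ ≤ ∑ n ∈ S, ‖c n‖ := by
      refine norm_sum_le_of_le _ fun n _ => ?_
      rw [norm_smul]
      exact mul_le_of_le_one_right (norm_nonneg _) (norm_expMode_le n)
    calc ‖specProj l u‖ ^ 2 ≤ (∑ n ∈ S, ‖c n‖) ^ 2 := by gcongr
      _ ≤ S.card * ∑ n ∈ S, ‖c n‖ ^ 2 := sq_sum_le_card_mul_sum_sq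
      _ = _ := by rw [hN]
  have hsum : (∑ n ∈ S, ‖c n‖ ^ 2) * (N ^ 2 * δ ^ (2 * N)) ≤ N * I := by
    rw [Finset.sum_mul]
    refine (Finset.sum_le_card_nsmul S _ I hcoeff).trans_eq ?_
    rw [hN, nsmul_eq_mul]
  rw [hint]
  have h4 : N * (‖specProj l u‖ ^ 2 * δ ^ (2 * N)) ≤ N * I := by
    calc N * (‖specProj l u‖ ^ 2 * δ ^ (2 * N))
        ≤ N * ((N * ∑ n ∈ S, ‖c n‖ ^ 2) * δ ^ (2 * N)) := by gcongr
      _ = (∑ n ∈ S, ‖c n‖ ^ 2) * (N ^ 2 * δ ^ (2 * N)) := by ring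
      _ ≤ _ := hsum
  exact le_of_mul_le_mul_left h4 hNpos

/-- Gives `L ≤ exp (L / log L)`, which lets a factor `L` be absorbed into the inner exponential. -/
theorem log_sq_le {L : ℝ} (hL : 1 < L) : Real.log L * Real.log L ≤ L := by
  have hs := Real.log_pos hL
  have h1 := Real.quadratic_le_exp_of_nonneg (by linarith : 0 ≤ Real.log L / 2)
  have h2 : L = Real.exp (Real.log L / 2) * Real.exp (Real.log L / 2) := by
    rw [← Real.exp_add, add_halves, Real.exp_log (by linarith)]
  have h3 : Real.log L ≤ Real.exp (Real.log L / 2) := by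
    nlinarith [sq_nonneg (Real.log L / 2 - 1)]
  calc Real.log L * Real.log L
      ≤ Real.exp (Real.log L / 2) * Real.exp (Real.log L / 2) := by gcongr
    _ = L := h2.symm

theorem pow_le_exp_exp {L : ℝ} (hL : 1 < L) {N : ℕ} (hN0 : N ≠ 0)
    (hN : (N : ℝ) ≤ Real.exp (347 * (L / Real.log L))) :
    (2 * N * Real.exp L) ^ (2 * N) ≤ Real.exp (Real.exp (698 * (L / Real.log L))) := by
  have hN1 : (1 : ℝ) ≤ N := by exact_mod_cast Nat.one_le_iff_ne_zero.2 hN0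
  have hL0 : 0 < L := by linarith
  have hQ := one_le_div_log hL
  have hLQ : L ≤ Real.exp (L / Real.log L) := by
    calc L = Real.exp (Real.log L) := (Real.exp_log hL0).symm
      _ ≤ _ := Real.exp_le_exp.2 ((le_div_iff₀ (Real.log_pos hL)).2 (log_sq_le hL))
  generalize L / Real.log L = Q at *
  have h1 : 2 * N * Real.exp L ≤ Real.exp (2 * N + L) := by
    rw [Real.exp_add]
    gcongr
    linarith [Real.add_one_le_exp (2 * N : ℝ)]
  have h2 : (2 * N : ℝ) * (2 * N + L) ≤ 6 * (N * N * L) := by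
    have h3 : (N : ℝ) * N * 1 ≤ N * N * L := by gcongr
    have h4 : (N : ℝ) * 1 * L ≤ N * N * L := by gcongr
    linarith
  have h6 : (6 : ℝ) ≤ Real.exp (3 * Q) := by
    have := Real.quadratic_le_exp_of_nonneg (by linarith : 0 ≤ 3 * Q)
    nlinarith
  calc (2 * N * Real.exp L) ^ (2 * N) ≤ Real.exp (2 * N + L) ^ (2 * N) := by gcongr
    _ = Real.exp (2 * N * (2 * N + L)) := by
        rw [← Real.exp_nat_mul]; push_cast; rfl
    _ ≤ Real.exp (6 * (N * N * L)) := Real.exp_le_exp.2 h2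
    -- `698 = 3 + 347 + 347 + 1`, from the factors `6`, `N`, `N` and `L`.
    _ ≤ Real.exp (Real.exp (3 * Q) *
          (Real.exp (347 * Q) * Real.exp (347 * Q) * Real.exp Q)) := by
        gcongr
    _ = _ := by
        rw [← Real.exp_add, ← Real.exp_add, ← Real.exp_add]; ring_nf

end

end TorusLowFreq

theorem mainTheorem7 :
    ∃ C : ℝ, 0 < C ∧ ∀ ε : ℝ, 0 < ε → ε < Real.exp (-1) →
      ∀ l : ℝ, l ≤ ε ^ (-17 : ℤ) → ∀ u₀ : TorusLowFreq.L2Torus,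
        ‖TorusLowFreq.specProj l u₀‖ ^ 2 ≤
          Real.exp (Real.exp (C * Real.log ε⁻¹ / Real.log (Real.log ε⁻¹))) *
            ∫ x in TorusLowFreq.smallBall ε, ‖TorusLowFreq.specProj l u₀ x‖ ^ 2 := by
  refine ⟨698, by norm_num, fun ε hε hε1 l hl u₀ => ?_⟩
  obtain ⟨L, hεL⟩ : ∃ L, ε = Real.exp (-L) := ⟨-Real.log ε, by rw [neg_neg, Real.exp_log hε]⟩
  have hL : 1 < L := by
    rw [hεL, Real.exp_lt_exp] at hε1
    linarith
  have hlog : Real.log ε⁻¹ = L := by rw [hεL, ← Real.exp_neg, neg_neg, Real.log_exp]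
  have hε1' : ε ≤ 1 := by rw [hεL]; exact Real.exp_le_one_iff.2 (by linarith)
  have hl' : l ≤ Real.exp (17 * L) := by
    refine hl.trans_eq ?_
    rw [zpow_neg, hεL, ← inv_zpow, ← Real.exp_neg, neg_neg]
    exact (Real.exp_nat_mul L 17).symm
  have hint0 : 0 ≤ ∫ x in TorusLowFreq.smallBall ε, ‖TorusLowFreq.specProj l u₀ x‖ ^ 2 :=
    MeasureTheory.integral_nonneg fun _ => by positivity
  have hNle := TorusLowFreq.card_freqSet_le hL hl'
  rw [hlog, mul_div_assoc]
  obtain ⟨N, hN⟩ : ∃ N, (TorusLowFreq.freqSet_finite l).toFinset.card = N := ⟨_, rfl⟩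
  rw [hN] at hNle
  rcases Nat.eq_zero_or_pos N with h0 | h0
  -- Here `l` is not an eigenvalue, and `ε / (2 * N)` would divide by zero.
  · have hz : TorusLowFreq.specProj l u₀ = 0 := by
      rw [TorusLowFreq.specProj, Finset.card_eq_zero.1 (hN.trans h0), Finset.sum_empty]
    have hz' : ‖TorusLowFreq.specProj l u₀‖ ^ 2 = 0 := by
      rw [hz, norm_zero, zero_pow two_ne_zero]
    rw [hz']
    exact mul_nonneg (Real.exp_nonneg _) hint0
  have key := TorusLowFreq.norm_specProj_sq_mul_le l u₀ hε hε1' hN h0.ne'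
  have hexp := TorusLowFreq.pow_le_exp_exp hL h0.ne' hNle
  have hN1 : (N : ℝ) ≠ 0 := Nat.cast_ne_zero.2 h0.ne'
  have hone : 2 * (N : ℝ) * Real.exp L * (ε / (2 * N)) = 1 := by
    rw [hεL, Real.exp_neg]; field_simp
  calc ‖TorusLowFreq.specProj l u₀‖ ^ 2
      = (2 * N * Real.exp L) ^ (2 * N) *
          (‖TorusLowFreq.specProj l u₀‖ ^ 2 * (ε / (2 * N)) ^ (2 * N)) := by
        rw [mul_left_comm, ← mul_pow, hone, one_pow, mul_one]
    _ ≤ _ := mul_le_mul hexp key (by positivity) (Real.exp_nonneg _)
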